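/- Let $S$ and $I$ be measurable spaces (for instance measure spaces), and let $\mathcal B=\mathcal B(S\times I,\mathbb R)$ be the Banach space of bounded measurable functions $f:S\times I\to\mathbb R$, written $f_i(x)=f(x,i)$, with the norm $\|f\|_\infty=\sup_{x\in S,\,i\in I}|f_i(x)|$. Let $a_i,b_i:S\to[-\infty,\infty]$ $(i\in I)$ be such that $(x,i)\mapsto a_i(x)$ and $(x,i)\mapsto b_i(x)$ are measurable, $a_i(x)<b_i(x)$ for all $x\in S$, $i\in I$, and $\inf_{i\in I,\,x\in S}\,(b_i(x)-a_i(x))>0$. For a function $f:S\times I\to\mathbb R$ let $[f]_a^b$ be the coordinatewise clip, $([f]_a^b)_i(x)=\min\{\max\{a_i(x),f_i(x)\},b_i(x)\}$, and let $M=\{f\in\mathcal B : [f]_a^b=f\}$ with the metric $d(f,g)=\|f-g\|_\infty$. Let $V:M\to\mathcal B$ be locally Lipschitz. Then $M$ is a complete metric space, and $X_t(f):=[f+tV(f)]_a^b$ $(f\in M,\ 0\le t\le 1)$ defines an arc field on $M$, i.e. a continuous map $X:M\times[0,1]\to M$ with $X_0(f)=f$, which satisfies the following conditions, where $B(f_0,r)$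 is the open ball. E1: for each $f_0\in M$ there are $r>0$, $\delta>0$ and $\Lambda\in\mathbb R$ with $d(X_t(f),X_t(g))\le(1+t\Lambda)\,d(f,g)$ for all $f,g\in B(f_0,r)$ and $t\in[0,1]$ with $t<\delta$. E2: for each $f_0\in M$ there are $r>0$, $\delta>0$ and $\Omega\in\mathbb R$ with $d(X_{s+t}(f),X_t(X_s(f)))\le st\,\Omega$ for all $f\in B(f_0,r)$ and $0\le t\le s<\delta$ with $s+t\le1$. By a local forward flow of $X$ we mean a function $T:M\to(0,\infty]$ such that $W_T=\{(f,t): 0\le t<T(f)\}$ is open in $M\times[0,\infty)$, together with a continuous map $F:W_T\to M$, $(f,t)\mapsto F_t(f)$, such that $F_0(f)=f$, such that $F_t(F_s(f))=F_{s+t}(f)$ whenever $s<T(f)$, $t<T(F_s(f))$ and $s+t<T(f)$, and such that $F$ is forward tangent to $X$: $$\lim_{h\to0^+}\frac{d\big(F_{t+h}(f),X_h(F_t(f))\big)}{h}=0\qquad\text{for all } (f,t)\in W_T .$$ There is a unique maximal local forward flow $(T,F)$ of $X$: for $s<T(f)$ one has $t<T(F_s(f))$ if and only if $s+t<T(f)$,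 and every local forward flow $(T',F')$ of $X$ is a restriction of it, i.e. $T'\le T$ and $F'_t(f)=F_t(f)$ for $0\le t<T'(f)$. If $V$ is globally Lipschitz, then $T\equiv\infty$, so that $F:M\times[0,\infty)\to M$ is a continuous semigroup that is forward tangent to $X$ at all $(f,t)$, and it is the only such semigroup. -/

import Mathlib

open Filter Topology
open scoped NNReal ENNReal unitInterval

/-! ### Arc fields and their flows on a metric space -/

section ArcFields

variable {M : Type*} [MetricSpace M]

/-- An arc field: a continuous map `X : M × [0,1] → M` with `X_0 = id`; `X f t` is `X_t(f)`. -/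
structure IsArcField (X : M → I → M) : Prop where
  continuous : Continuous (Function.uncurry X)
  zero : ∀ f, X f 0 = f

/-- Condition E1. -/
def CondE1 (X : M → I → M) : Prop :=
  ∀ f₀ : M, ∃ r > (0 : ℝ), ∃ δ > (0 : ℝ), ∃ Λ : ℝ,
    ∀ f ∈ Metric.ball f₀ r, ∀ g ∈ Metric.ball f₀ r, ∀ t : I, (t : ℝ) < δ →
      dist (X f t) (X g t) ≤ (1 + t * Λ) * dist f g

/-- Condition E2. The parameter `u` is `s + t`, which has to lie in `[0,1]`. -/
def CondE2 (X : M → I → M) : Prop :=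
  ∀ f₀ : M, ∃ r > (0 : ℝ), ∃ δ > (0 : ℝ), ∃ Ω : ℝ,
    ∀ f ∈ Metric.ball f₀ r, ∀ s t u : I, (u : ℝ) = s + t → t ≤ s → (s : ℝ) < δ →
      dist (X f u) (X (X f s) t) ≤ s * t * Ω

/-- The curve `γ` is forward tangent to `X` at time `t`:
`d(γ(t+h), X_h(γ(t))) / h → 0` as `h → 0⁺`. -/
def TangentAt (X : M → I → M) (γ : ℝ≥0 → M) (t : ℝ≥0) : Prop :=
  Tendsto (fun h : I => dist (γ (t + unitInterval.toNNReal h)) (X (γ t) h) / (h : ℝ))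
    (𝓝[>] 0) (𝓝 0)

/-- A (global) forward flow of `X`: a continuous semigroup `F : M × [0,∞) → M` that is forward
tangent to `X`; `F f t` is `F_t(f)`. -/
structure IsFlowOf (X : M → I → M) (F : M → ℝ≥0 → M) : Prop where
  continuous : Continuous (Function.uncurry F)
  zero : ∀ f, F f 0 = f
  add : ∀ f s t, F (F f s) t = F f (s + t)
  tangent : ∀ f t, TangentAt X (F f) t

/-- The domain `{(f,t) | 0 ≤ t < T(f)}` in `M × [0,∞)` determined by a lifetime function `T`. -/
def lifeDomain (T : M → ℝ≥0∞) : Set (M × ℝ≥0) := {p | (p.2 : ℝ≥0∞) < T p.1}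

/-- A local forward flow of `X` with lifetimes `T : M → (0,∞]`: it is defined on
`{(f,t) | 0 ≤ t < T(f)}` (values of `F` outside this set carry no meaning), which is open in
`M × [0,∞)`, is continuous there, has the semigroup property as far as it is defined, and is
forward tangent to `X`. -/
structure IsLocalFlowOf (X : M → I → M) (T : M → ℝ≥0∞) (F : M → ℝ≥0 → M) : Prop where
  pos : ∀ f, 0 < T f
  isOpen : IsOpen (lifeDomain T)
  continuousOn : ContinuousOn (Function.uncurry F) (lifeDomain T)
  zero : ∀ f, F f 0 = f
  add : ∀ (f : M) (s t : ℝ≥0), (s : ℝ≥0∞) < T f → (t : ℝ≥0∞) < T (F f s) →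
    ((s + t : ℝ≥0) : ℝ≥0∞) < T f → F (F f s) t = F f (s + t)
  tangent : ∀ (f : M) (t : ℝ≥0), (t : ℝ≥0∞) < T f → TangentAt X (F f) t

end ArcFields

/-! ### Clipping -/

section Clip

/-- The clip `[x]_a^b = min (max a x) b` of a real number at extended real bounds; it is a real
number whenever `a < b`. -/
noncomputable def clip (a b : EReal) (x : ℝ) : ℝ := (min (max a (x : EReal)) b).toReal

theorem coe_clip {a b : EReal} (h : a < b) (x : ℝ) :
    ((clip a b x : ℝ) : EReal) = min (max a (x : EReal)) b := by
  refine EReal.coe_toReal (ne_of_lt ?_) (ne_of_gt ?_)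
  · exact (min_lt_iff.2 (Or.inl (max_lt (lt_of_lt_of_le h le_top) (EReal.coe_lt_top x))))
  · exact lt_min (lt_max_of_lt_right (EReal.bot_lt_coe x)) (lt_of_le_of_lt bot_le h)

theorem clip_clip {a b : EReal} (h : a < b) (x : ℝ) : clip a b (clip a b x) = clip a b x := by
  have : ((clip a b (clip a b x) : ℝ) : EReal) = (clip a b x : ℝ) := by
    rw [coe_clip h, coe_clip h]
    rw [max_eq_right (le_min (le_max_left _ _) h.le), min_eq_left (min_le_right _ _)]
  exact_mod_cast this

theorem abs_clip_sub_clip_le {a b : EReal} (h : a < b) (x y : ℝ) :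
    |clip a b x - clip a b y| ≤ |x - y| := by
  wlog hxy : x ≤ y generalizing x y
  · rw [abs_sub_comm, abs_sub_comm x]
    exact this y x (le_of_not_ge hxy)
  have key : ((clip a b y : ℝ) : EReal) ≤ ((clip a b x + (y - x) : ℝ) : EReal) := by
    have hd : (0 : EReal) ≤ ((y - x : ℝ) : EReal) := by exact_mod_cast sub_nonneg.2 hxy
    rw [EReal.coe_add, coe_clip h, coe_clip h]
    rcases le_total b (max a (x : EReal)) with h1 | h1
    · rw [min_eq_right h1]
      exact (min_le_right _ _).trans (le_add_of_nonneg_right hd)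
    · rw [min_eq_left h1]
      refine (min_le_left _ _).trans (max_le ?_ ?_)
      · exact (le_max_left _ _).trans (le_add_of_nonneg_right hd)
      · calc (y : EReal) = (x : EReal) + ((y - x : ℝ) : EReal) := by
              rw [← EReal.coe_add]; congr 1; ring
          _ ≤ _ := by gcongr; exact le_max_right _ _
  have mono : ((clip a b x : ℝ) : EReal) ≤ ((clip a b y : ℝ) : EReal) := by
    rw [coe_clip h, coe_clip h]
    exact min_le_min_right _ (max_le_max_left _ (by exact_mod_cast hxy))
  have key' : clip a b y ≤ clip a b x + (y - x) := by exact_mod_cast key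
  have mono' : clip a b x ≤ clip a b y := by exact_mod_cast mono
  rw [abs_sub_comm, abs_sub_comm x, abs_of_nonneg (by linarith), abs_of_nonneg (by linarith)]
  linarith

end Clip

/-! ### Bounded measurable functions -/

section BoundedMeasurable

/-- The space `𝓑(Ω, ℝ)` of bounded measurable functions `Ω → ℝ` (genuine functions, not classes)
with the supremum norm, as a subspace of the space `ℓ^∞(Ω)` of all bounded functions. -/
def BddMeas (Ω : Type*) [MeasurableSpace Ω] : Submodule ℝ (lp (fun _ : Ω => ℝ) ∞) where
  carrier := {f | Measurable fun p => f p}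
  add_mem' := fun {_ _} hf hg => Measurable.add hf hg
  zero_mem' := measurable_const
  smul_mem' := fun c _ hf => Measurable.const_smul hf c

variable {S J : Type*} [MeasurableSpace S] [MeasurableSpace J]

/-- The coordinatewise clip `([g]_a^b)(x, i) = [g(x, i)]_{a_i(x)}^{b_i(x)}`. -/
noncomputable def clipFun (a b : J → S → EReal) (g : S × J → ℝ) : S × J → ℝ :=
  fun p => clip (a p.2 p.1) (b p.2 p.1) (g p)

/-- The set `M = {f ∈ 𝓑(S × J, ℝ) | [f]_a^b = f}`, a metric space with the metric `‖f - g‖_∞`. -/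
def clipSpace (a b : J → S → EReal) : Set (BddMeas (S × J)) :=
  {f | clipFun a b (fun p => f.1 p) = fun p => f.1 p}

/-- The arc field `X_t(f) = [f + t V(f)]_a^b` on `M`. -/
noncomputable def clipArc {a b : J → S → EReal}
    (ha : Measurable fun p : S × J => a p.2 p.1) (hb : Measurable fun p : S × J => b p.2 p.1)
    (hab : ∀ i x, a i x < b i x) (V : clipSpace a b → BddMeas (S × J))
    (f : clipSpace a b) (t : I) : clipSpace a b :=
  ⟨⟨⟨clipFun a b fun p => f.1.1 p + (t : ℝ) * (V f).1 p, by
        refine memℓp_infty ⟨‖f.1.1‖ + |(t : ℝ)| * ‖(V f).1‖, ?_⟩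
        rintro _ ⟨p, rfl⟩
        have h1 := abs_clip_sub_clip_le (hab p.2 p.1) (f.1.1 p + (t : ℝ) * (V f).1 p) (f.1.1 p)
        have h2 : clip (a p.2 p.1) (b p.2 p.1) (f.1.1 p) = f.1.1 p := congrFun f.2 p
        have h3 : |f.1.1 p| ≤ ‖f.1.1‖ := lp.norm_apply_le_norm ENNReal.top_ne_zero f.1.1 p
        have h4 : |(V f).1 p| ≤ ‖(V f).1‖ := lp.norm_apply_le_norm ENNReal.top_ne_zero (V f).1 p
        rw [h2, add_sub_cancel_left, abs_mul] at h1
        have h5 := mul_le_mul_of_nonneg_left h4 (abs_nonneg (t : ℝ))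
        have h6 := abs_sub_abs_le_abs_sub
          (clip (a p.2 p.1) (b p.2 p.1) (f.1.1 p + (t : ℝ) * (V f).1 p)) (f.1.1 p)
        change |clip (a p.2 p.1) (b p.2 p.1) (f.1.1 p + (t : ℝ) * (V f).1 p)| ≤ _
        linarith⟩, by
      have hf : Measurable fun p => f.1.1 p := f.1.2
      have hV : Measurable fun p => (V f).1 p := (V f).2
      exact ((ha.max (hf.add (hV.const_mul (t : ℝ))).coe_real_ereal).min hb).ereal_toReal⟩, by
    funext p
    exact clip_clip (hab p.2 p.1) _⟩

end BoundedMeasurable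

/-!
Call a curve an `ε`-approximate solution of an arc field `X` if its forward tangency defect is at
most `ε`. By E1 and Grönwall's inequality, two approximate solutions with defects `ε` and `ε'`
satisfy `d(γ(t), β(t)) ≤ (d(γ(0), β(0)) + (ε + ε') t) exp(K t)`. By E2, the arc of `X` at any point
has defect at most `η Ω` on `[0, η]`, so concatenating arcs of length `η` gives Euler polygons whose
defect tends to `0` with `η`. They converge uniformly to an exact solution by the comparison
estimate, which also gives uniqueness and Lipschitz dependence on the initial value; gluing exact
solutions yields the maximal flow. If the speed of the arcs grows at most linearly, a solution on
`[0, T)` with `T < ∞` stays bounded, hence is Lipschitz, hence has a limit at `T`, and the uniform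
existence time near this limit carries it beyond `T`.

For the clipping arcs, E1 and the speed bound hold because clipping is 1-Lipschitz. For E2, clipping
once after two increments of the same sign is the same as clipping after each of them, so
`X_{s+t}(f)` and `X_t(X_s(f))` differ by at most `t ‖V(f) - V(X_s(f))‖`, which is `O(s t)`.
-/

open Set

/-! ### Grönwall estimates along one-sided increments -/

section Gronwall

theorem map_add_coe_nhdsGT_zero (t : ℝ) : map (fun h : I => t + h) (𝓝[>] 0) = 𝓝[>] t := by
  have hcoe : map ((↑) : I → ℝ) (𝓝[>] 0) = 𝓝[>] 0 := by
    have himage : ((↑) : I → ℝ) '' Ioi 0 = Ioc 0 1 := by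
      ext x
      exact ⟨fun ⟨h, h0, hx⟩ => hx ▸ ⟨h0, h.2.2⟩, fun hx => ⟨⟨x, hx.1.le, hx.2⟩, hx.1, rfl⟩⟩
    rw [IsEmbedding.subtypeVal.map_nhdsWithin_eq, himage]
    exact nhdsWithin_Ioc_eq_nhdsGT one_pos
  calc map (fun h : I => t + h) (𝓝[>] 0) = map (t + ·) (map ((↑) : I → ℝ) (𝓝[>] 0)) :=
        Filter.map_map.symm
    _ = 𝓝[>] t := by rw [hcoe, map_add_left_nhdsGT, add_zero]

theorem eventually_nhdsGT_iff_add_coe {t : ℝ} {p : ℝ → Prop} :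
    (∀ᶠ z in 𝓝[>] t, p z) ↔ ∀ᶠ h : I in 𝓝[>] 0, p (t + h) := by
  rw [← map_add_coe_nhdsGT_zero, eventually_map]

theorem tendsto_coe_nhdsGT_zero : Tendsto ((↑) : I → ℝ) (𝓝[>] 0) (𝓝[>] 0) := by
  simpa only [Tendsto, zero_add] using (map_add_coe_nhdsGT_zero 0).le

theorem eventually_coe_pos : ∀ᶠ h : I in 𝓝[>] 0, (0 : ℝ) < h :=
  self_mem_nhdsWithin

theorem eventually_coe_lt {δ : ℝ} (hδ : 0 < δ) : ∀ᶠ h : I in 𝓝[>] 0, (h : ℝ) < δ :=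
  tendsto_coe_nhdsGT_zero.eventually (Iio_mem_nhds hδ |> mem_nhdsWithin_of_mem_nhds)

theorem eventually_forall_mem_Icc {E : Type*} [TopologicalSpace E] {γ : ℝ → E} {τ : ℝ}
    (hγ : ContinuousOn γ (Icc 0 τ)) (hτ : 0 < τ) {U : Set E} (hU : U ∈ 𝓝 (γ 0)) :
    ∀ᶠ d in 𝓝[>] 0, ∀ t ∈ Icc 0 d, γ t ∈ U := by
  have hγ0 : ContinuousWithinAt γ (Ici 0) 0 :=
    (hγ 0 ⟨le_rfl, hτ.le⟩).mono_of_mem_nhdsWithin (Icc_mem_nhdsGE hτ)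
  obtain ⟨u, hu, huU⟩ := mem_nhdsGE_iff_exists_Icc_subset.1 (hγ0 hU)
  filter_upwards [Ioo_mem_nhdsGT hu] with d hd t ht
  exact huU ⟨ht.1, ht.2.trans hd.2.le⟩

theorem gronwallBound_le_mul_exp {δ K ε x : ℝ} (hK : 0 ≤ K) (hε : 0 ≤ ε) :
    gronwallBound δ K ε x ≤ (δ + ε * x) * Real.exp (K * x) := by
  rcases hK.eq_or_lt with rfl | hK'
  · simp [gronwallBound_K0]
  have hexp : Real.exp (K * x) - 1 ≤ K * x * Real.exp (K * x) := by
    have h := mul_le_mul_of_nonneg_right (Real.add_one_le_exp (-(K * x))) (Real.exp_pos (K * x)).le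
    rw [← Real.exp_add, neg_add_cancel, Real.exp_zero] at h
    linarith
  calc gronwallBound δ K ε x
      = δ * Real.exp (K * x) + ε / K * (Real.exp (K * x) - 1) := by
        rw [gronwallBound_of_K_ne_0 hK'.ne']
    _ ≤ δ * Real.exp (K * x) + ε / K * (K * x * Real.exp (K * x)) := by gcongr
    _ = (δ + ε * x) * Real.exp (K * x) := by field_simp

theorem le_gronwallBound_of_eventually_sub_le {φ : ℝ → ℝ} {K ε τ : ℝ}
    (hφ : ContinuousOn φ (Icc 0 τ))
    (hslope : ∀ t ∈ Ico 0 τ, ∀ η > 0, ∀ᶠ h : I in 𝓝[>] 0,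
      φ (t + h) - φ t ≤ (K * φ t + ε + η) * h) {t : ℝ} (ht : t ∈ Icc 0 τ) :
    φ t ≤ gronwallBound (φ 0) K ε t := by
  suffices H : ∀ x ∈ Ico 0 τ, ∀ r, K * φ x + ε < r →
      ∀ᶠ z in 𝓝[>] x, (z - x)⁻¹ * (φ z - φ x) < r by
    simpa using le_gronwallBound_of_liminf_deriv_right_le hφ
      (fun x hx r hr => (H x hx r hr).frequently) le_rfl (fun _ _ => le_rfl) t ht
  intro x hx r hr
  rw [eventually_nhdsGT_iff_add_coe]
  have hη : 0 < (r - (K * φ x + ε)) / 2 := by linarith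
  filter_upwards [hslope x hx _ hη, eventually_coe_pos] with h hh h0
  rw [add_sub_cancel_left, inv_mul_lt_iff₀ h0]
  nlinarith

end Gronwall

section ContinuousInduction

theorem exists_gt_of_local_step {P : ℝ → Prop} {t₀ : ℝ} (ht₀ : 0 ≤ t₀) (h0 : P 0)
    (hstep : ∀ x ∈ Icc 0 t₀, ∃ τ > 0, ∀ᶠ t in 𝓝[≤] x, t ∈ Icc 0 t₀ → P t → P (t + τ)) :
    ∃ τ > t₀, P τ := by
  by_contra! hP
  have hlub : IsLUB {t ∈ Icc 0 t₀ | P t} (sSup {t ∈ Icc 0 t₀ | P t}) :=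
    isLUB_csSup ⟨0, ⟨le_rfl, ht₀⟩, h0⟩ ⟨t₀, fun t ht => ht.1.2⟩
  set x := sSup {t ∈ Icc 0 t₀ | P t}
  have hx : x ∈ Icc 0 t₀ := ⟨hlub.1 ⟨⟨le_rfl, ht₀⟩, h0⟩, hlub.2 fun t ht => ht.1.2⟩
  obtain ⟨τ, hτ, hτ'⟩ := hstep x hx
  have hnear : ∀ᶠ t in 𝓝[≤] x, x - τ < t :=
    mem_nhdsWithin_of_mem_nhds (Ioi_mem_nhds (by linarith))
  obtain ⟨t, ⟨ht, hPt⟩, htτ, hxt⟩ :=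
    ((hlub.frequently_mem ⟨0, ⟨le_rfl, ht₀⟩, h0⟩).and_eventually (hτ'.and hnear)).exists
  have hPτ := htτ ht hPt
  rcases le_or_gt (t + τ) t₀ with hle | hgt
  · linarith [hlub.1 ⟨⟨by linarith [ht.1], hle⟩, hPτ⟩]
  · exact hP _ hgt hPτ

end ContinuousInduction

/-! ### Approximate solutions -/

section ArcCurve

variable {M : Type*}

/-- The arc `t ↦ X_t(f)` as a curve on the whole real line, constant outside `[0, 1]`. -/
noncomputable def arcCurve (X : M → I → M) (f : M) : ℝ → M :=
  IccExtend zero_le_one (X f)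

theorem arcCurve_coe (X : M → I → M) (f : M) (t : I) : arcCurve X f t = X f t :=
  IccExtend_val _ _ _

theorem arcCurve_of_mem (X : M → I → M) (f : M) {t : ℝ} (ht : t ∈ Icc (0 : ℝ) 1) :
    arcCurve X f t = X f ⟨t, ht⟩ :=
  IccExtend_of_mem _ _ ht

theorem IsArcField.arcCurve_zero [MetricSpace M] {X : M → I → M} (hX : IsArcField X) (f : M) :
    arcCurve X f 0 = f :=
  (arcCurve_coe X f 0).trans (hX.zero f)

theorem IsArcField.continuous_arcCurve [MetricSpace M] {X : M → I → M} (hX : IsArcField X)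
    (f : M) : Continuous (arcCurve X f) :=
  (hX.continuous.comp (Continuous.prodMk_right f)).Icc_extend'

end ArcCurve

section ApproxSolutions

variable {M : Type*} [MetricSpace M]

/-- A continuous curve `γ` on `[0, τ]` whose forward tangency defect
`limsup d(γ(t+h), X_h(γ(t))) / h` as `h → 0⁺` is at most `ε` at every `t ∈ [0, τ)`. For `ε = 0` the
curve is an exact solution of `X`. The values of `γ` outside `[0, τ]` carry no meaning. -/
structure IsApproxSolution (X : M → I → M) (ε : ℝ) (γ : ℝ → M) (τ : ℝ) : Prop where
  continuousOn : ContinuousOn γ (Icc 0 τ)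
  tangent : ∀ t ∈ Ico 0 τ, ∀ η > ε, ∀ᶠ h : I in 𝓝[>] 0, dist (γ (t + h)) (X (γ t) h) ≤ η * h

/-- Uniform constants for the local conditions on an arc field: on `U` and for times less than `δ`,
`X` satisfies E1 with constant `K` and E2 with constant `Ω`, and its arcs have speed at most `C`. -/
structure ArcBoundsOn (X : M → I → M) (U : Set M) (δ : ℝ) (K C Ω : ℝ≥0) : Prop where
  pos : 0 < δ
  le_one : δ ≤ 1
  dist_le : ∀ f ∈ U, ∀ g ∈ U, ∀ t : I, (t : ℝ) < δ → dist (X f t) (X g t) ≤ (1 + t * K) * dist f g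
  speed : ∀ f ∈ U, ∀ t : I, (t : ℝ) < δ → dist (X f t) f ≤ C * t
  semigroup : ∀ f ∈ U, ∀ s t u : I, (u : ℝ) = s + t → t ≤ s → (s : ℝ) < δ →
    dist (X f u) (X (X f s) t) ≤ s * t * Ω

namespace IsApproxSolution

variable {X : M → I → M} {ε ε' τ τ' : ℝ} {γ β : ℝ → M}

theorem const_zero (f : M) : IsApproxSolution X ε (fun _ => f) 0 :=
  ⟨continuousOn_const, fun t ht => by simp at ht⟩

theorem mono (h : IsApproxSolution X ε γ τ) (hτ : τ' ≤ τ) : IsApproxSolution X ε γ τ' :=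
  ⟨h.continuousOn.mono (Icc_subset_Icc_right hτ),
    fun t ht => h.tangent t (Ico_subset_Ico_right hτ ht)⟩

theorem congr (h : IsApproxSolution X ε γ τ) (he : EqOn β γ (Icc 0 τ)) :
    IsApproxSolution X ε β τ := by
  refine ⟨h.continuousOn.congr he, fun t ht η hη => ?_⟩
  filter_upwards [h.tangent t ht η hη, eventually_coe_lt (sub_pos.2 ht.2)] with s hs hsτ
  rwa [he (Ico_subset_Icc_self ht), he ⟨add_nonneg ht.1 s.2.1, by linarith⟩]

theorem shift (h : IsApproxSolution X ε γ τ) {s : ℝ} (hs : 0 ≤ s) :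
    IsApproxSolution X ε (fun t => γ (s + t)) (τ - s) where
  continuousOn := h.continuousOn.comp (by fun_prop)
    fun t ht => ⟨add_nonneg hs ht.1, by linarith [ht.2]⟩
  tangent t ht := by
    simpa only [add_assoc] using h.tangent (s + t) ⟨add_nonneg hs ht.1, by linarith [ht.2]⟩

theorem concat (h : IsApproxSolution X ε γ τ) (h' : IsApproxSolution X ε β τ') (hτ : 0 ≤ τ)
    (hτ' : 0 ≤ τ') (he : β 0 = γ τ) :
    IsApproxSolution X ε (fun t => if t ≤ τ then γ t else β (t - τ)) (τ + τ') := by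
  have hleft : ∀ {t}, t ≤ τ → (if t ≤ τ then γ t else β (t - τ)) = γ t := fun ht => if_pos ht
  have hright : ∀ {t}, τ ≤ t → (if t ≤ τ then γ t else β (t - τ)) = β (t - τ) := fun {t} ht => by
    rcases ht.eq_or_lt with rfl | hlt
    · simp [he]
    · exact if_neg hlt.not_ge
  constructor
  · rw [← Icc_union_Icc_eq_Icc hτ (le_add_of_nonneg_right hτ')]
    refine (h.continuousOn.congr fun t ht => hleft ht.2).union_of_isClosed
      (ContinuousOn.congr (f := fun t => β (t - τ)) ?_ fun t ht => hright ht.1)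
      isClosed_Icc isClosed_Icc
    exact h'.continuousOn.comp (by fun_prop) fun t ht => ⟨by linarith [ht.1], by linarith [ht.2]⟩
  · intro t ht η hη
    rcases lt_or_ge t τ with htτ | htτ
    · filter_upwards [h.tangent t ⟨ht.1, htτ⟩ η hη, eventually_coe_lt (sub_pos.2 htτ)]
        with s hs hsτ
      rwa [hleft htτ.le, hleft (by linarith)]
    · filter_upwards [h'.tangent (t - τ) ⟨by linarith, by linarith [ht.2]⟩ η hη] with s hs
      rwa [hright htτ, hright (by linarith [s.2.1]), add_sub_right_comm]

theorem dist_le_of_arcBoundsOn {U : Set M} {δ : ℝ} {K C Ω : ℝ≥0} (hX : ArcBoundsOn X U δ K C Ω)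
    (h : IsApproxSolution X ε γ τ) (h' : IsApproxSolution X ε' β τ) (hε : 0 ≤ ε + ε')
    (hγ : ∀ t ∈ Icc 0 τ, γ t ∈ U) (hβ : ∀ t ∈ Icc 0 τ, β t ∈ U) {t : ℝ} (ht : t ∈ Icc 0 τ) :
    dist (γ t) (β t) ≤ (dist (γ 0) (β 0) + (ε + ε') * t) * Real.exp (K * t) := by
  refine (le_gronwallBound_of_eventually_sub_le (φ := fun t => dist (γ t) (β t))
    (continuous_dist.comp_continuousOn (h.continuousOn.prodMk h'.continuousOn)) ?_ ht).trans
    (gronwallBound_le_mul_exp K.2 hε)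
  intro t ht η hη
  filter_upwards [h.tangent t ht (ε + η / 2) (by linarith),
    h'.tangent t ht (ε' + η / 2) (by linarith), eventually_coe_lt hX.pos] with s hγs hβs hsδ
  have hlip := hX.dist_le _ (hγ t (Ico_subset_Icc_self ht)) _ (hβ t (Ico_subset_Icc_self ht)) s hsδ
  have htri := dist_triangle4_right (γ (t + s)) (β (t + s)) (X (γ t) s) (X (β t) s)
  linarith

theorem dist_le_of_speed {p : M} {A B : ℝ} (h : IsApproxSolution X ε γ τ)
    (hspeed : ∀ t ∈ Ico 0 τ, ∀ᶠ s : I in 𝓝[>] 0,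
      dist (X (γ t) s) (γ t) ≤ (A * dist (γ t) p + B) * s) {t : ℝ} (ht : t ∈ Icc 0 τ) :
    dist (γ t) p ≤ gronwallBound (dist (γ 0) p) A (B + ε) t := by
  refine le_gronwallBound_of_eventually_sub_le (φ := fun t => dist (γ t) p)
    (continuous_dist.comp_continuousOn (h.continuousOn.prodMk continuousOn_const)) ?_ ht
  intro t ht η hη
  filter_upwards [h.tangent t ht (ε + η) (by linarith), hspeed t ht] with s hγs hs
  have htri := dist_triangle4 (γ (t + s)) (X (γ t) s) (γ t) p
  linarith

end IsApproxSolution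

namespace ArcBoundsOn

variable {X : M → I → M} {U : Set M} {δ : ℝ} {K C Ω : ℝ≥0}

theorem isApproxSolution_arcCurve (hb : ArcBoundsOn X U δ K C Ω) (hX : IsArcField X) {f : M}
    (hf : f ∈ U) {τ : ℝ} (hτ : τ ≤ δ) :
    IsApproxSolution X (τ * Ω) (arcCurve X f) τ := by
  refine ⟨(hX.continuous_arcCurve f).continuousOn, fun t ht η hη => ?_⟩
  have hτ1 := hτ.trans hb.le_one
  have htI : t ∈ Icc (0 : ℝ) 1 := ⟨ht.1, ht.2.le.trans hτ1⟩
  rw [arcCurve_of_mem X f htI]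
  rcases ht.1.eq_or_lt with rfl | ht0
  · have hη0 : 0 < η := (mul_nonneg ht.2.le Ω.2).trans_lt hη
    refine Eventually.of_forall fun h => ?_
    change dist _ (X (X f 0) h) ≤ _
    rw [zero_add, arcCurve_coe, hX.zero, dist_self]
    exact mul_nonneg hη0.le h.2.1
  · filter_upwards [eventually_coe_lt ht0, eventually_coe_lt (sub_pos.2 (ht.2.trans_le hτ1))]
      with h hht hh1
    rw [arcCurve_of_mem X f (⟨add_nonneg ht.1 h.2.1, by linarith⟩ : t + h ∈ Icc (0 : ℝ) 1)]
    calc _ ≤ t * h * (Ω : ℝ) :=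
          hb.semigroup f hf ⟨t, htI⟩ h ⟨t + h, _⟩ rfl hht.le (ht.2.trans_le hτ)
      _ = t * Ω * h := by ring
      _ ≤ η * h := by
        have hΩ : t * Ω ≤ τ * Ω := by gcongr; exact ht.2.le
        exact mul_le_mul_of_nonneg_right (hΩ.trans hη.le) h.2.1

theorem dist_arcCurve_le (hb : ArcBoundsOn X U δ K C Ω) {f : M} (hf : f ∈ U) {t : ℝ}
    (ht : t ∈ Ico 0 δ) : dist (arcCurve X f t) f ≤ C * t := by
  have htI : t ∈ Icc (0 : ℝ) 1 := ⟨ht.1, ht.2.le.trans hb.le_one⟩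
  rw [arcCurve_of_mem X f htI]
  exact hb.speed f hf ⟨t, htI⟩ ht.2

end ArcBoundsOn

end ApproxSolutions

section LocalExistence

variable {M : Type*} [MetricSpace M] {X : M → I → M} {U : Set M} {δ : ℝ} {K C Ω : ℝ≥0}

theorem ArcBoundsOn.exists_eulerPolygon (hb : ArcBoundsOn X U δ K C Ω) (hX : IsArcField X)
    {f : M} {ρ : ℝ} (hU : Metric.ball f ρ ⊆ U) {η : ℝ} (hη : 0 ≤ η) (hηδ : η < δ) (k : ℕ)
    (hk : C * (k * η) < ρ) :
    ∃ γ : ℝ → M, γ 0 = f ∧ IsApproxSolution X (η * Ω) γ (k * η) ∧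
      ∀ t ∈ Icc 0 (k * η), dist (γ t) f ≤ C * t := by
  induction k with
  | zero =>
    rw [Nat.cast_zero, zero_mul]
    exact ⟨fun _ => f, rfl, .const_zero f, fun t ht => by
      simpa using mul_nonneg C.2 ht.1⟩
  | succ k ih =>
    rw [Nat.cast_succ, add_one_mul] at hk ⊢
    have hkη : 0 ≤ k * η := by positivity
    have hCη : 0 ≤ C * η := by positivity
    obtain ⟨γ, h0, hγ, hdist⟩ := ih (by linarith)
    have hmem : γ (k * η) ∈ U :=
      hU (Metric.mem_ball.2 (by linarith [hdist (k * η) ⟨hkη, le_rfl⟩]))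
    refine ⟨_, ?_, hγ.concat (hb.isApproxSolution_arcCurve hX hmem hηδ.le) hkη hη
      (hX.arcCurve_zero _), fun t ht => ?_⟩
    · simp only [if_pos hkη, h0]
    · rcases le_or_gt t (k * η) with htk | htk
      · simpa only [if_pos htk] using hdist t ⟨ht.1, htk⟩
      · rw [if_neg htk.not_ge]
        calc _ ≤ dist (arcCurve X (γ (k * η)) (t - k * η)) (γ (k * η))
              + dist (γ (k * η)) f := dist_triangle _ _ _
          _ ≤ C * (t - k * η) + C * (k * η) := add_le_add
              (hb.dist_arcCurve_le hmem ⟨by linarith, by linarith [ht.2]⟩)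
              (hdist _ ⟨hkη, le_rfl⟩)
          _ = C * t := by ring

theorem IsApproxSolution.of_tendstoUniformlyOn (hb : ArcBoundsOn X U δ K C Ω) (hX : IsArcField X)
    (hU : IsOpen U) {e : ℕ → ℝ} (he0 : ∀ n, 0 ≤ e n) (he : Tendsto e atTop (𝓝 0))
    {γ : ℕ → ℝ → M} {g : ℝ → M} {τ : ℝ} (hγ : ∀ n, IsApproxSolution X (e n) (γ n) τ)
    (hγU : ∀ n, ∀ t ∈ Icc 0 τ, γ n t ∈ U) (hg : ∀ t ∈ Icc 0 τ, g t ∈ U)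
    (hlim : TendstoUniformlyOn γ g atTop (Icc 0 τ)) : IsApproxSolution X 0 g τ := by
  refine ⟨hlim.continuousOn (Frequently.of_forall fun n => (hγ n).continuousOn),
    fun t ht η hη => ?_⟩
  have htτ := Ico_subset_Icc_self ht
  have hgt := hg t htτ
  have hαU : ∀ᶠ h in 𝓝[>] (0 : ℝ), ∀ s ∈ Icc 0 h, arcCurve X (g t) s ∈ U :=
    eventually_forall_mem_Icc (hX.continuous_arcCurve _).continuousOn one_pos
      (hU.mem_nhds (by rwa [hX.arcCurve_zero]))
  have hsmall : ∀ᶠ h in 𝓝[>] (0 : ℝ), h * Ω * Real.exp (K * h) < η := by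
    have hcont : Continuous fun h : ℝ => h * Ω * Real.exp (K * h) := by fun_prop
    exact ((hcont.tendsto 0).eventually_lt_const (by simpa using hη)).filter_mono
      nhdsWithin_le_nhds
  filter_upwards [tendsto_coe_nhdsGT_zero.eventually hαU, tendsto_coe_nhdsGT_zero.eventually hsmall,
    eventually_coe_lt hb.pos, eventually_coe_lt (sub_pos.2 ht.2)] with h hhU hhη hhδ hhτ
  have hh : (h : ℝ) ∈ Icc (0 : ℝ) h := ⟨h.2.1, le_rfl⟩
  -- Compare the approximations, restarted at time `t`, with the arc from the limit point `g t`,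
  -- whose defect `h * Ω` on `[0, h]` vanishes with `h`.
  have hcompare : ∀ n, dist (γ n (t + h)) (X (g t) h) ≤
      (dist (γ n t) (g t) + (e n + h * Ω) * h) * Real.exp (K * h) := fun n => by
    have := (((hγ n).shift ht.1).mono hhτ.le).dist_le_of_arcBoundsOn hb
      (hb.isApproxSolution_arcCurve hX hgt hhδ.le)
      (add_nonneg (he0 n) (mul_nonneg h.2.1 Ω.2))
      (fun s hs => hγU n _ ⟨add_nonneg ht.1 hs.1, by linarith [hs.2]⟩) hhU hh
    rwa [add_zero, hX.arcCurve_zero, arcCurve_coe] at this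
  have hγlim : ∀ s ∈ Icc 0 τ, Tendsto (fun n => γ n s) atTop (𝓝 (g s)) :=
    fun s hs => hlim.tendsto_at hs
  have hle : dist (g (t + h)) (X (g t) h) ≤ (dist (g t) (g t) + (0 + h * Ω) * h) *
      Real.exp (K * h) :=
    le_of_tendsto_of_tendsto' ((hγlim _ ⟨add_nonneg ht.1 h.2.1, by linarith⟩).dist
      tendsto_const_nhds) ((((hγlim t htτ).dist tendsto_const_nhds).add
        ((he.add_const _).mul_const _)).mul_const _) hcompare
  calc dist (g (t + h)) (X (g t) h) ≤ h * Ω * Real.exp (K * h) * h := by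
        rw [dist_self] at hle; linarith
    _ ≤ η * h := by gcongr; exact h.2.1

theorem ArcBoundsOn.uniformCauchySeqOn (hb : ArcBoundsOn X U δ K C Ω) {f : M} {e : ℕ → ℝ}
    (he0 : ∀ n, 0 ≤ e n) (he : Tendsto e atTop (𝓝 0)) {γ : ℕ → ℝ → M} {τ : ℝ}
    (hγ0 : ∀ n, γ n 0 = f) (hγ : ∀ n, IsApproxSolution X (e n) (γ n) τ)
    (hγU : ∀ n, ∀ t ∈ Icc 0 τ, γ n t ∈ U) : UniformCauchySeqOn γ atTop (Icc 0 τ) := by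
  have hdist : ∀ n m, ∀ t ∈ Icc 0 τ,
      dist (γ n t) (γ m t) ≤ (e n + e m) * (τ * Real.exp (K * τ)) := fun n m t ht => by
    have hnm := add_nonneg (he0 n) (he0 m)
    have hτ : 0 ≤ τ := ht.1.trans ht.2
    calc dist (γ n t) (γ m t) ≤ (dist (γ n 0) (γ m 0) + (e n + e m) * t) * Real.exp (K * t) :=
          (hγ n).dist_le_of_arcBoundsOn hb (hγ m) hnm (hγU n) (hγU m) ht
      _ = (e n + e m) * (t * Real.exp (K * t)) := by rw [hγ0, hγ0, dist_self]; ring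
      _ ≤ _ := by gcongr <;> exact ht.2
  have hlim : Tendsto (fun p : ℕ × ℕ => (e p.1 + e p.2) * (τ * Real.exp (K * τ)))
      (atTop ×ˢ atTop) (𝓝 0) := by
    simpa using ((he.comp tendsto_fst).add (he.comp tendsto_snd)).mul_const (τ * Real.exp (K * τ))
  intro u hu
  obtain ⟨ξ, hξ, hξu⟩ := Metric.mem_uniformity_dist.1 hu
  filter_upwards [hlim.eventually_lt_const hξ] with p hp t ht
  exact hξu ((hdist p.1 p.2 t ht).trans_lt hp)

theorem ArcBoundsOn.exists_solution [CompleteSpace M] (hb : ArcBoundsOn X U δ K C Ω)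
    (hX : IsArcField X) (hUo : IsOpen U) {f : M} {ρ τ : ℝ} (hU : Metric.ball f ρ ⊆ U)
    (hτ : 0 ≤ τ) (hτδ : τ < δ) (hτρ : C * τ < ρ) :
    ∃ γ : ℝ → M, γ 0 = f ∧ IsApproxSolution X 0 γ τ ∧ ∀ t ∈ Icc 0 τ, dist (γ t) f ≤ C * t := by
  set e : ℕ → ℝ := fun n => τ / (n + 1)
  have he0 : ∀ n, 0 ≤ e n := fun n => by positivity
  have he : Tendsto (fun n => e n * Ω) atTop (𝓝 0) := by
    simpa [e, Function.comp_def] using ((tendsto_const_div_atTop_nhds_zero_nat τ).comp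
      (tendsto_add_atTop_nat 1)).mul_const (Ω : ℝ)
  have hγ : ∀ n : ℕ, ∃ γ : ℝ → M, γ 0 = f ∧ IsApproxSolution X (e n * Ω) γ τ ∧
      ∀ t ∈ Icc 0 τ, dist (γ t) f ≤ C * t := fun n => by
    have hne : ((n + 1 : ℕ) : ℝ) * e n = τ := by
      rw [Nat.cast_add_one]; exact mul_div_cancel₀ _ (by positivity)
    have heδ : e n < δ := (div_le_self hτ (by simp)).trans_lt hτδ
    simpa only [hne] using hb.exists_eulerPolygon hX hU (he0 n) heδ (n + 1) (by rwa [hne])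
  choose γ hγ0 hγ hγdist using hγ
  have hmem : ∀ {p : M} {t : ℝ}, t ∈ Icc 0 τ → dist p f ≤ C * t → p ∈ U := fun ht hp =>
    hU (Metric.mem_ball.2 ((hp.trans (by gcongr; exact ht.2)).trans_lt hτρ))
  have hγU : ∀ n, ∀ t ∈ Icc 0 τ, γ n t ∈ U := fun n t ht => hmem ht (hγdist n t ht)
  have heΩ : ∀ n, 0 ≤ e n * Ω := fun n => mul_nonneg (he0 n) Ω.2
  have hcauchy := hb.uniformCauchySeqOn heΩ he hγ0 hγ hγU
  have : Nonempty M := ⟨f⟩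
  choose! g hg using fun t ht => cauchySeq_tendsto_of_complete (hcauchy.cauchySeq (x := t) ht)
  have hgdist : ∀ t ∈ Icc 0 τ, dist (g t) f ≤ C * t := fun t ht =>
    le_of_tendsto' ((hg t ht).dist tendsto_const_nhds) fun n => hγdist n t ht
  refine ⟨g, ?_, .of_tendstoUniformlyOn hb hX hUo heΩ he hγ hγU
    (fun t ht => hmem ht (hgdist t ht)) (hcauchy.tendstoUniformlyOn_of_tendsto hg), hgdist⟩
  simpa using hgdist 0 ⟨le_rfl, hτ⟩

end LocalExistence

/-! ### The maximal flow of an arc field -/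

section MaximalFlow

variable {M : Type*} [MetricSpace M]

/-- The arcs of `X` have locally bounded speed. -/
def CondSpeed (X : M → I → M) : Prop :=
  ∀ f₀ : M, ∃ r > (0 : ℝ), ∃ δ > (0 : ℝ), ∃ C : ℝ,
    ∀ f ∈ Metric.ball f₀ r, ∀ t : I, (t : ℝ) < δ → dist (X f t) f ≤ C * t

/-- An arc field satisfying E1 and E2 whose arcs have locally bounded speed: the arc fields that
generate a maximal local flow if the space is complete. -/
structure IsRegularArcField (X : M → I → M) : Prop extends IsArcField X where
  condE1 : CondE1 X
  condE2 : CondE2 X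
  condSpeed : CondSpeed X

/-- Some exact solution of `X` on `[0, τ]` starts at `f`. -/
def HasSolution (X : M → I → M) (f : M) (τ : ℝ) : Prop :=
  ∃ γ : ℝ → M, γ 0 = f ∧ IsApproxSolution X 0 γ τ

/-- The supremum of the times up to which an exact solution starting at `f` exists. -/
noncomputable def lifetime (X : M → I → M) (f : M) : ℝ≥0∞ :=
  ⨆ (τ : ℝ≥0) (_ : HasSolution X f τ), (τ : ℝ≥0∞)

open Classical in
/-- The value at time `t` of the exact solutions on `[0, t]` starting at `f`, all of which agree if
`X` is regular; the junk value `f` if there is no such solution. -/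
noncomputable def maximalFlow (X : M → I → M) (f : M) (t : ℝ) : M :=
  if h : HasSolution X f t then h.choose t else f

variable {X : M → I → M} {f : M}

theorem IsRegularArcField.exists_arcBoundsOn (hX : IsRegularArcField X) (f₀ : M) :
    ∃ r > 0, ∃ δ K C Ω, ArcBoundsOn X (Metric.ball f₀ r) δ K C Ω := by
  obtain ⟨r₁, hr₁, δ₁, hδ₁, Λ, hΛ⟩ := hX.condE1 f₀
  obtain ⟨r₂, hr₂, δ₂, hδ₂, Ω, hΩ⟩ := hX.condE2 f₀
  obtain ⟨r₃, hr₃, δ₃, hδ₃, C, hC⟩ := hX.condSpeed f₀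
  refine ⟨min r₁ (min r₂ r₃), by positivity, min 1 (min δ₁ (min δ₂ δ₃)), Λ.toNNReal, C.toNNReal,
    Ω.toNNReal, by positivity, min_le_left _ _, fun f hf g hg t ht => ?_, fun f hf t ht => ?_,
    fun f hf s t u hu hts hs => ?_⟩
  · simp only [Metric.mem_ball, lt_min_iff] at hf hg ht
    refine (hΛ f hf.1 g hg.1 t ht.2.1).trans ?_
    gcongr
    exacts [t.2.1, Real.le_coe_toNNReal _]
  · simp only [Metric.mem_ball, lt_min_iff] at hf ht
    refine (hC f hf.2.2 t ht.2.2.2).trans ?_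
    gcongr
    exacts [t.2.1, Real.le_coe_toNNReal _]
  · simp only [Metric.mem_ball, lt_min_iff] at hf hs
    refine (hΩ f hf.2.1 s t u hu hts hs.2.2.1).trans ?_
    gcongr
    exacts [mul_nonneg s.2.1 t.2.1, Real.le_coe_toNNReal _]

theorem IsApproxSolution.eqOn (hX : IsRegularArcField X) {γ β : ℝ → M} {τ : ℝ}
    (h : IsApproxSolution X 0 γ τ) (h' : IsApproxSolution X 0 β τ) (h0 : γ 0 = β 0) :
    EqOn γ β (Icc 0 τ) := by
  refine IsClosed.Icc_subset_of_forall_exists_gt (s := {t | γ t = β t}) ?_ h0 ?_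
  · have := (h.continuousOn.prodMk h'.continuousOn).preimage_isClosed_of_isClosed isClosed_Icc
      (isClosed_diagonal (X := M))
    rwa [inter_comm] at this
  · rintro x ⟨hx : γ x = β x, hxτ⟩ y hy
    obtain ⟨r, hr, δ, K, C, Ω, hb⟩ := hX.exists_arcBoundsOn (γ x)
    have hball : Metric.ball (γ x) r ∈ 𝓝 (γ x) := Metric.ball_mem_nhds _ hr
    have hγ := h.shift hxτ.1
    have hβ := h'.shift hxτ.1
    have hτx : 0 < τ - x := sub_pos.2 hxτ.2
    obtain ⟨d, hγd, hβd, hd, hdmin⟩ :=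
      ((eventually_forall_mem_Icc hγ.continuousOn hτx (by rwa [add_zero])).and <|
        (eventually_forall_mem_Icc hβ.continuousOn hτx (by rwa [add_zero, ← hx])).and <|
        Ioo_mem_nhdsGT (lt_min hτx (sub_pos.2 hy))).exists
    rw [lt_min_iff] at hdmin
    have hdist := (hγ.mono hdmin.1.le).dist_le_of_arcBoundsOn hb (hβ.mono hdmin.1.le) (by simp)
      hγd hβd ⟨hd.le, le_rfl⟩
    simp only [add_zero, hx, dist_self, zero_mul] at hdist
    exact ⟨x + d, dist_le_zero.1 hdist, by linarith, by linarith⟩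

theorem hasSolution_zero (f : M) : HasSolution X f 0 :=
  ⟨fun _ => f, rfl, .const_zero f⟩

theorem HasSolution.mono {τ τ' : ℝ} (h : HasSolution X f τ) (hτ : τ' ≤ τ) :
    HasSolution X f τ' :=
  let ⟨γ, h0, hγ⟩ := h
  ⟨γ, h0, hγ.mono hτ⟩

theorem lt_lifetime_iff {t : ℝ≥0} :
    (t : ℝ≥0∞) < lifetime X f ↔ ∃ τ : ℝ≥0, t < τ ∧ HasSolution X f τ := by
  simp only [lifetime, lt_iSup_iff, ENNReal.coe_lt_coe, exists_prop]
  exact exists_congr fun _ => and_comm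

theorem HasSolution.le_lifetime {τ : ℝ≥0} (h : HasSolution X f τ) : (τ : ℝ≥0∞) ≤ lifetime X f :=
  le_iSup₂_of_le τ h le_rfl

theorem hasSolution_of_lt_lifetime {t : ℝ≥0} (ht : (t : ℝ≥0∞) < lifetime X f) :
    HasSolution X f t :=
  let ⟨_, hτ, h⟩ := lt_lifetime_iff.1 ht
  h.mono (NNReal.coe_le_coe.2 hτ.le)

theorem maximalFlow_zero (f : M) : maximalFlow X f 0 = f := by
  rw [maximalFlow, dif_pos (hasSolution_zero f)]
  exact (hasSolution_zero (X := X) f).choose_spec.1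

theorem IsApproxSolution.maximalFlow_eq (hX : IsRegularArcField X) {γ : ℝ → M} {τ : ℝ}
    (h : IsApproxSolution X 0 γ τ) {t : ℝ} (ht : t ∈ Icc 0 τ) :
    maximalFlow X (γ 0) t = γ t := by
  have hsol : HasSolution X (γ 0) t := ⟨γ, rfl, h.mono ht.2⟩
  rw [maximalFlow, dif_pos hsol]
  exact hsol.choose_spec.2.eqOn hX (h.mono ht.2) hsol.choose_spec.1 ⟨ht.1, le_rfl⟩

namespace HasSolution

theorem isApproxSolution (hX : IsRegularArcField X) {τ : ℝ} (h : HasSolution X f τ) :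
    IsApproxSolution X 0 (maximalFlow X f) τ := by
  obtain ⟨γ, rfl, hγ⟩ := h
  exact hγ.congr fun t ht => hγ.maximalFlow_eq hX ht

theorem add (hX : IsRegularArcField X) {s t : ℝ} (hs : 0 ≤ s) (ht : 0 ≤ t)
    (h : HasSolution X f s) (h' : HasSolution X (maximalFlow X f s) t) :
    HasSolution X f (s + t) := by
  refine ⟨_, ?_, (h.isApproxSolution hX).concat (h'.isApproxSolution hX) hs ht
    (maximalFlow_zero _)⟩
  simp only [if_pos hs, maximalFlow_zero]

theorem isApproxSolution_shift (hX : IsRegularArcField X) {s t : ℝ} (hs : 0 ≤ s)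
    (h : HasSolution X f (s + t)) : IsApproxSolution X 0 (fun u => maximalFlow X f (s + u)) t := by
  simpa only [add_sub_cancel_left] using (h.isApproxSolution hX).shift hs

theorem of_add (hX : IsRegularArcField X) {s t : ℝ} (hs : 0 ≤ s) (h : HasSolution X f (s + t)) :
    HasSolution X (maximalFlow X f s) t :=
  ⟨_, by simp only [add_zero], h.isApproxSolution_shift hX hs⟩

theorem maximalFlow_maximalFlow (hX : IsRegularArcField X) {s t : ℝ} (hs : 0 ≤ s) (ht : 0 ≤ t)
    (h : HasSolution X f (s + t)) :
    maximalFlow X (maximalFlow X f s) t = maximalFlow X f (s + t) := by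
  simpa only [add_zero] using (h.isApproxSolution_shift hX hs).maximalFlow_eq hX ⟨ht, le_rfl⟩

end HasSolution

theorem lt_lifetime_maximalFlow_iff (hX : IsRegularArcField X) {s t : ℝ≥0}
    (hs : (s : ℝ≥0∞) < lifetime X f) :
    (t : ℝ≥0∞) < lifetime X (maximalFlow X f s) ↔ ((s + t : ℝ≥0) : ℝ≥0∞) < lifetime X f := by
  rw [lt_lifetime_iff, lt_lifetime_iff]
  constructor
  · rintro ⟨τ, hτ, h⟩
    refine ⟨s + τ, by gcongr, ?_⟩
    rw [NNReal.coe_add]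
    exact (hasSolution_of_lt_lifetime hs).add hX s.2 τ.2 h
  · rintro ⟨τ, hτ, h⟩
    obtain ⟨u, rfl⟩ := exists_add_of_le (le_self_add.trans hτ.le)
    rw [NNReal.coe_add] at h
    exact ⟨u, lt_of_add_lt_add_left hτ, h.of_add hX s.2⟩

end MaximalFlow

section InitialValues

variable {M : Type*} [MetricSpace M] {X : M → I → M} {f : M}

theorem IsRegularArcField.exists_lipschitz [CompleteSpace M] (hX : IsRegularArcField X) (p : M) :
    ∃ r > 0, ∃ τ > 0, ∃ L : ℝ≥0, ∀ f ∈ Metric.ball p r, HasSolution X f τ ∧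
      ∀ g ∈ Metric.ball p r, ∀ t ∈ Icc 0 τ,
        dist (maximalFlow X f t) (maximalFlow X g t) ≤ L * dist f g := by
  obtain ⟨R, hR, δ, K, C, Ω, hb⟩ := hX.exists_arcBoundsOn p
  obtain ⟨τ, hCτ, hτ, hτδ⟩ : ∃ τ : ℝ, C * τ < R / 2 ∧ τ ∈ Ioo 0 δ := by
    have hC : Continuous fun τ : ℝ => C * τ := by fun_prop
    exact ((((hC.tendsto 0).eventually_lt_const (by simpa using hR)).filter_mono
      nhdsWithin_le_nhds).and (Ioo_mem_nhdsGT hb.pos)).exists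
  have hsub : ∀ f ∈ Metric.ball p (R / 2), Metric.ball f (R / 2) ⊆ Metric.ball p R :=
    fun f hf => Metric.ball_subset_ball' (by linarith [Metric.mem_ball.1 hf])
  have hsol : ∀ f ∈ Metric.ball p (R / 2), HasSolution X f τ ∧
      ∀ t ∈ Icc 0 τ, maximalFlow X f t ∈ Metric.ball p R := fun f hf => by
    obtain ⟨γ, rfl, hγ, hdist⟩ :=
      hb.exists_solution hX.toIsArcField Metric.isOpen_ball (hsub f hf) hτ.le hτδ hCτ
    refine ⟨⟨γ, rfl, hγ⟩, fun t ht => ?_⟩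
    rw [hγ.maximalFlow_eq hX ht]
    refine hsub _ hf (Metric.mem_ball.2 (((hdist t ht).trans ?_).trans_lt hCτ))
    gcongr
    exact ht.2
  refine ⟨R / 2, by positivity, τ, hτ, (Real.exp (K * τ)).toNNReal,
    fun f hf => ⟨(hsol f hf).1, fun g hg t ht => ?_⟩⟩
  rw [Real.coe_toNNReal _ (Real.exp_pos _).le]
  calc dist (maximalFlow X f t) (maximalFlow X g t)
      ≤ (dist (maximalFlow X f 0) (maximalFlow X g 0) + (0 + 0) * t) * Real.exp (K * t) :=
        ((hsol f hf).1.isApproxSolution hX).dist_le_of_arcBoundsOn hb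
          ((hsol g hg).1.isApproxSolution hX) (by simp) (hsol f hf).2 (hsol g hg).2 ht
    _ = Real.exp (K * t) * dist f g := by rw [maximalFlow_zero, maximalFlow_zero]; ring
    _ ≤ Real.exp (K * τ) * dist f g := by gcongr; exact ht.2

/-- The solution from `f` up to time `t` is stable: solutions from all initial values near `f` exist
up to time `t`, at a distance from it that is Lipschitz in the initial value. -/
def StableUpTo (X : M → I → M) (f : M) (t : ℝ) : Prop :=
  ∃ L : ℝ≥0, ∀ᶠ g in 𝓝 f, HasSolution X g t ∧
    ∀ s ∈ Icc 0 t, dist (maximalFlow X f s) (maximalFlow X g s) ≤ L * dist f g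

theorem stableUpTo_zero (f : M) : StableUpTo X f 0 := by
  refine ⟨1, Eventually.of_forall fun g => ⟨hasSolution_zero g, fun s hs => ?_⟩⟩
  obtain rfl : s = 0 := le_antisymm hs.2 hs.1
  simp only [maximalFlow_zero, NNReal.coe_one, one_mul, le_refl]

theorem StableUpTo.tendsto {t : ℝ} (h : StableUpTo X f t) (ht : 0 ≤ t) :
    Tendsto (maximalFlow X · t) (𝓝 f) (𝓝 (maximalFlow X f t)) := by
  obtain ⟨L, hL⟩ := h
  refine tendsto_iff_dist_tendsto_zero.2 (squeeze_zero' (g := fun g => L * dist f g)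
    (Eventually.of_forall fun _ => dist_nonneg) ?_ ?_)
  · filter_upwards [hL] with g hg
    rw [dist_comm]
    exact hg.2 t ⟨ht, le_rfl⟩
  · exact (continuous_const.mul (continuous_const.dist continuous_id)).tendsto' f 0 (by simp)

theorem StableUpTo.add (hX : IsRegularArcField X) {t τ : ℝ} (ht : 0 ≤ t) (hτ : 0 ≤ τ)
    (h : StableUpTo X f t) {U : Set M} (hU : U ∈ 𝓝 (maximalFlow X f t)) {L' : ℝ≥0}
    (hloc : ∀ f ∈ U, HasSolution X f τ ∧ ∀ g ∈ U, ∀ u ∈ Icc 0 τ,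
      dist (maximalFlow X f u) (maximalFlow X g u) ≤ L' * dist f g) :
    StableUpTo X f (t + τ) := by
  obtain ⟨L, hL⟩ := h
  have hextend : ∀ {g}, HasSolution X g t → maximalFlow X g t ∈ U → HasSolution X g (t + τ) :=
    fun hg hgU => hg.add hX ht hτ (hloc _ hgU).1
  have hf := hextend hL.self_of_nhds.1 (mem_of_mem_nhds hU)
  refine ⟨max L (L' * L), ?_⟩
  filter_upwards [hL, StableUpTo.tendsto ⟨L, hL⟩ ht hU] with g hg hgU
  have hg' := hextend hg.1 hgU
  refine ⟨hg', fun s hs => ?_⟩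
  rcases le_or_gt s t with hst | hst
  · refine (hg.2 s ⟨hs.1, hst⟩).trans ?_
    gcongr
    exact le_max_left _ _
  obtain ⟨u, rfl⟩ : ∃ u, s = t + u := ⟨s - t, by ring⟩
  have hu : u ∈ Icc 0 τ := ⟨by linarith, by linarith [hs.2]⟩
  rw [← (hf.mono hs.2).maximalFlow_maximalFlow hX ht hu.1,
    ← (hg'.mono hs.2).maximalFlow_maximalFlow hX ht hu.1]
  calc _ ≤ L' * dist (maximalFlow X f t) (maximalFlow X g t) :=
        (hloc _ (mem_of_mem_nhds hU)).2 _ hgU u hu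
    _ ≤ L' * (L * dist f g) := by gcongr; exact hg.2 t ⟨ht, le_rfl⟩
    _ = (L' * L : ℝ≥0) * dist f g := by rw [NNReal.coe_mul, mul_assoc]
    _ ≤ _ := by gcongr; exact le_max_right _ _

theorem HasSolution.exists_stableUpTo [CompleteSpace M] (hX : IsRegularArcField X) {t₀ : ℝ}
    (ht₀ : 0 ≤ t₀) (h : HasSolution X f t₀) : ∃ τ > t₀, StableUpTo X f τ := by
  refine exists_gt_of_local_step ht₀ (stableUpTo_zero f) fun x hx => ?_
  obtain ⟨r, hr, τ, hτ, L, hloc⟩ := hX.exists_lipschitz (maximalFlow X f x)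
  have hnear : ∀ᶠ t in 𝓝[Icc 0 t₀] x, maximalFlow X f t ∈ Metric.ball (maximalFlow X f x) r :=
    (h.isApproxSolution hX).continuousOn x hx (Metric.ball_mem_nhds _ hr)
  refine ⟨τ, hτ, ?_⟩
  filter_upwards [(eventually_nhdsWithin_iff.1 hnear).filter_mono nhdsWithin_le_nhds]
    with t htball ht hstable
  exact hstable.add hX ht.1 hτ.le (Metric.isOpen_ball.mem_nhds (htball ht)) hloc

end InitialValues

section LocalFlow

variable {M : Type*} [MetricSpace M] {X : M → I → M}

theorem tangentAt_iff {γ : ℝ≥0 → M} {t : ℝ≥0} :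
    TangentAt X γ t ↔ ∀ η > 0, ∀ᶠ h : I in 𝓝[>] 0,
      dist (γ (t + unitInterval.toNNReal h)) (X (γ t) h) ≤ η * h := by
  rw [TangentAt, Metric.tendsto_nhds]
  constructor
  · intro H η hη
    filter_upwards [H η hη, eventually_coe_pos] with h hh h0
    rw [Real.dist_0_eq_abs, abs_of_nonneg (by positivity), div_lt_iff₀ h0] at hh
    exact hh.le
  · intro H η hη
    filter_upwards [H (η / 2) (half_pos hη), eventually_coe_pos] with h hh h0
    rw [Real.dist_0_eq_abs, abs_of_nonneg (by positivity), div_lt_iff₀ h0]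
    exact hh.trans_lt (by gcongr; exact half_lt_self hη)

theorem isApproxSolution_of_tangentAt {γ : ℝ≥0 → M} {τ : ℝ≥0} (hγ : ContinuousOn γ (Iic τ))
    (htan : ∀ t < τ, TangentAt X γ t) : IsApproxSolution X 0 (fun t => γ t.toNNReal) τ := by
  refine ⟨hγ.comp continuous_real_toNNReal.continuousOn
    fun t ht => Real.toNNReal_le_iff_le_coe.2 ht.2, fun t ht η hη => ?_⟩
  filter_upwards [tangentAt_iff.1 (htan _ ((Real.toNNReal_lt_iff_lt_coe ht.1).2 ht.2)) η hη]
    with h hh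
  have hcoe : (h : ℝ).toNNReal = unitInterval.toNNReal h :=
    Real.toNNReal_coe (r := unitInterval.toNNReal h)
  rwa [Real.toNNReal_add ht.1 h.2.1, hcoe]

theorem IsApproxSolution.tangentAt {γ : ℝ → M} {τ : ℝ} (h : IsApproxSolution X 0 γ τ) {t : ℝ≥0}
    (ht : t < τ) : TangentAt X (fun s => γ s) t :=
  tangentAt_iff.2 (h.tangent t ⟨t.2, ht⟩)

theorem exists_stableUpTo_of_lt_lifetime [CompleteSpace M] (hX : IsRegularArcField X) {f : M}
    {t : ℝ≥0} (ht : (t : ℝ≥0∞) < lifetime X f) : ∃ τ : ℝ≥0, t < τ ∧ StableUpTo X f τ := by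
  obtain ⟨τ, hτ, hstable⟩ := (hasSolution_of_lt_lifetime ht).exists_stableUpTo hX t.2
  lift τ to ℝ≥0 using t.2.trans hτ.le
  exact ⟨τ, hτ, hstable⟩

theorem lifetime_pos [CompleteSpace M] (hX : IsRegularArcField X) (f : M) : 0 < lifetime X f := by
  obtain ⟨τ, hτ, hstable⟩ := (hasSolution_zero f).exists_stableUpTo hX le_rfl
  obtain ⟨L, hL⟩ := hstable
  lift τ to ℝ≥0 using hτ.le
  exact (ENNReal.coe_pos.2 hτ).trans_le hL.self_of_nhds.1.le_lifetime

theorem isOpen_lifeDomain_lifetime [CompleteSpace M] (hX : IsRegularArcField X) :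
    IsOpen (lifeDomain (lifetime X)) := by
  refine isOpen_iff_mem_nhds.2 fun ⟨f, t⟩ hft => ?_
  obtain ⟨τ, hτ, L, hL⟩ := exists_stableUpTo_of_lt_lifetime hX hft
  filter_upwards [hL.prod_nhds (Iio_mem_nhds hτ)] with q hq
  exact lt_lifetime_iff.2 ⟨τ, hq.2, hq.1.1⟩

theorem continuousOn_maximalFlow [CompleteSpace M] (hX : IsRegularArcField X) :
    ContinuousOn (Function.uncurry fun (f : M) (t : ℝ≥0) => maximalFlow X f t)
      (lifeDomain (lifetime X)) := by
  refine continuousOn_of_forall_continuousAt fun ⟨f, t⟩ hft => ?_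
  obtain ⟨τ, hτ, L, hL⟩ := exists_stableUpTo_of_lt_lifetime hX hft
  have htime : ContinuousAt (fun s : ℝ≥0 => maximalFlow X f s) t :=
    ((hL.self_of_nhds.1.isApproxSolution hX).continuousOn.comp
      NNReal.continuous_coe.continuousOn fun s hs => ⟨s.2, NNReal.coe_le_coe.2 hs⟩).continuousAt
      (Iic_mem_nhds hτ)
  have hbound : ContinuousAt (fun q : M × ℝ≥0 =>
      L * dist f q.1 + dist (maximalFlow X f q.2) (maximalFlow X f t)) (f, t) :=
    (by fun_prop : ContinuousAt (fun q : M × ℝ≥0 => L * dist f q.1) (f, t)).add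
      ((htime.comp_of_eq continuousAt_snd rfl).dist continuousAt_const)
  refine tendsto_iff_dist_tendsto_zero.2 (squeeze_zero' (Eventually.of_forall fun _ => dist_nonneg)
    ?_ (by simpa using hbound.tendsto))
  filter_upwards [hL.prod_nhds (Iio_mem_nhds hτ)] with q hq
  refine (dist_triangle _ (maximalFlow X f q.2) _).trans (add_le_add_left ?_ _)
  rw [dist_comm]
  exact hq.1.2 q.2 ⟨q.2.2, NNReal.coe_le_coe.2 hq.2.le⟩

theorem isLocalFlowOf_maximalFlow [CompleteSpace M] (hX : IsRegularArcField X) :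
    IsLocalFlowOf X (lifetime X) (fun f t => maximalFlow X f t) where
  pos := lifetime_pos hX
  isOpen := isOpen_lifeDomain_lifetime hX
  continuousOn := continuousOn_maximalFlow hX
  zero := maximalFlow_zero
  add f s t _ _ hst := by
    have h := hasSolution_of_lt_lifetime hst
    rw [NNReal.coe_add] at h ⊢
    exact h.maximalFlow_maximalFlow hX s.2 t.2
  tangent f t ht := by
    obtain ⟨τ, hτ, h⟩ := lt_lifetime_iff.1 ht
    exact (h.isApproxSolution hX).tangentAt hτ

namespace IsLocalFlowOf

variable {T : M → ℝ≥0∞} {F : M → ℝ≥0 → M}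

theorem isApproxSolution (hF : IsLocalFlowOf X T F) {f : M} {t : ℝ≥0} (ht : (t : ℝ≥0∞) < T f) :
    IsApproxSolution X 0 (fun s => F f s.toNNReal) t :=
  isApproxSolution_of_tangentAt
    (hF.continuousOn.comp (f := fun s => (f, s)) (by fun_prop) fun _ hs =>
      (ENNReal.coe_le_coe.2 hs).trans_lt ht)
    fun s hs => hF.tangent f s ((ENNReal.coe_lt_coe.2 hs).trans ht)

theorem le_lifetime (hF : IsLocalFlowOf X T F) (f : M) : T f ≤ lifetime X f :=
  ENNReal.le_of_forall_nnreal_lt fun _ ht =>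
    HasSolution.le_lifetime ⟨_, by simpa using hF.zero f, hF.isApproxSolution ht⟩

theorem eq_maximalFlow (hF : IsLocalFlowOf X T F) (hX : IsRegularArcField X) {f : M} {t : ℝ≥0}
    (ht : (t : ℝ≥0∞) < T f) : F f t = maximalFlow X f t := by
  have h := (hF.isApproxSolution ht).maximalFlow_eq hX ⟨t.coe_nonneg, le_rfl⟩
  simpa only [Real.toNNReal_zero, hF.zero, Real.toNNReal_coe] using h.symm

end IsLocalFlowOf

theorem isFlowOf_iff_isLocalFlowOf_top {F : M → ℝ≥0 → M} :
    IsFlowOf X F ↔ IsLocalFlowOf X (fun _ => ∞) F := by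
  have huniv : lifeDomain (fun _ : M => ∞) = univ := eq_univ_of_forall fun _ => ENNReal.coe_lt_top
  constructor
  · intro h
    exact ⟨fun _ => ENNReal.zero_lt_top, huniv ▸ isOpen_univ, h.continuous.continuousOn, h.zero,
      fun f s t _ _ _ => h.add f s t, fun f t _ => h.tangent f t⟩
  · intro h
    exact ⟨continuousOn_univ.1 (huniv ▸ h.continuousOn), h.zero,
      fun f s t => h.add f s t ENNReal.coe_lt_top ENNReal.coe_lt_top ENNReal.coe_lt_top,
      fun f t => h.tangent f t ENNReal.coe_lt_top⟩

theorem isFlowOf_maximalFlow [CompleteSpace M] (hX : IsRegularArcField X)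
    (htop : ∀ f, lifetime X f = ∞) : IsFlowOf X (fun f t => maximalFlow X f t) :=
  isFlowOf_iff_isLocalFlowOf_top.2 (funext htop ▸ isLocalFlowOf_maximalFlow hX)

theorem IsFlowOf.eq_maximalFlow {F : M → ℝ≥0 → M} (hF : IsFlowOf X F) (hX : IsRegularArcField X) :
    F = fun f (t : ℝ≥0) => maximalFlow X f t :=
  funext₂ fun _ _ =>
    (isFlowOf_iff_isLocalFlowOf_top.1 hF).eq_maximalFlow hX ENNReal.coe_lt_top

end LocalFlow

/-! ### Flows for all times -/

section GlobalFlow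

variable {M : Type*} [MetricSpace M] {X : M → I → M}

/-- The speed of the arcs of `X` grows at most linearly with the distance from any given point, so
that solutions cannot escape in finite time. -/
def HasLinearSpeedGrowth (X : M → I → M) : Prop :=
  ∀ p : M, ∃ C : ℝ≥0, ∀ f (t : I), dist (X f t) f ≤ C * (1 + dist f p) * t

namespace HasLinearSpeedGrowth

theorem exists_dist_le (hlin : HasLinearSpeedGrowth X) (hX : IsRegularArcField X) (f : M) (T : ℝ) :
    ∃ R, ∀ t ∈ Icc 0 T, HasSolution X f t → dist (maximalFlow X f t) f ≤ R := by
  obtain ⟨C, hC⟩ := hlin f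
  refine ⟨(0 + C * T) * Real.exp (C * T), fun t ht hsol => ?_⟩
  calc dist (maximalFlow X f t) f
      ≤ gronwallBound (dist (maximalFlow X f 0) f) (C) (C + 0) t := by
        refine (hsol.isApproxSolution hX).dist_le_of_speed (fun u _ => ?_) ⟨ht.1, le_rfl⟩
        refine Eventually.of_forall fun s => (hC _ s).trans_eq ?_
        ring
    _ ≤ (0 + C * t) * Real.exp (C * t) := by
        rw [maximalFlow_zero, dist_self, add_zero]
        exact gronwallBound_le_mul_exp C.2 C.2
    _ ≤ (0 + C * T) * Real.exp (C * T) := by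
        gcongr
        exacts [add_nonneg le_rfl (mul_nonneg C.2 (ht.1.trans ht.2)), ht.2, ht.2]

theorem exists_lipschitzOnWith (hlin : HasLinearSpeedGrowth X) (hX : IsRegularArcField X) {f : M}
    {T : ℝ} (hsol : ∀ t ∈ Ico 0 T, HasSolution X f t) :
    ∃ B, LipschitzOnWith B (maximalFlow X f) (Ico 0 T) := by
  obtain ⟨C, hC⟩ := hlin f
  obtain ⟨R, hR⟩ := hlin.exists_dist_le hX f T
  refine ⟨(C * (1 + R)).toNNReal, .of_dist_le_mul fun t ht s hs => ?_⟩
  wlog hst : s ≤ t generalizing s t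
  · rw [dist_comm, dist_comm t]
    exact this s hs t ht (le_of_not_ge hst)
  obtain ⟨u, rfl⟩ : ∃ u, t = s + u := ⟨t - s, by ring⟩
  have hu : 0 ≤ u := by linarith
  have h := ((hsol _ ht).isApproxSolution_shift hX hs.1).dist_le_of_speed (p := maximalFlow X f s)
    (A := 0) (B := C * (1 + R)) (fun v hv => ?_) ⟨hu, le_rfl⟩
  · rw [add_zero, dist_self, add_zero, gronwallBound_K0] at h
    simp only [zero_add] at h
    rw [Real.dist_eq, add_sub_cancel_left, abs_of_nonneg hu]
    exact h.trans (by gcongr; exact Real.le_coe_toNNReal _)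
  · refine Eventually.of_forall fun w => (hC _ w).trans ?_
    rw [zero_mul, zero_add]
    have hv : s + v ∈ Ico 0 T := ⟨add_nonneg hs.1 hv.1, by linarith [hv.2, ht.2]⟩
    gcongr
    exacts [w.2.1, hR _ (Ico_subset_Icc_self hv) (hsol _ hv)]

theorem lifetime_eq_top [CompleteSpace M] (hlin : HasLinearSpeedGrowth X)
    (hX : IsRegularArcField X) (f : M) : lifetime X f = ∞ := by
  by_contra hfinite
  lift lifetime X f to ℝ≥0 using hfinite with T hT
  have hT0 : (0 : ℝ) < T := ENNReal.coe_pos.1 (hT ▸ lifetime_pos hX f)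
  have hsol : ∀ t ∈ Ico 0 (T : ℝ), HasSolution X f t := fun t ht => by
    lift t to ℝ≥0 using ht.1
    exact hasSolution_of_lt_lifetime (hT ▸ ENNReal.coe_lt_coe.2 ht.2)
  obtain ⟨B, hB⟩ := hlin.exists_lipschitzOnWith hX hsol
  have hIco : Ico 0 (T : ℝ) ∈ 𝓝[<] (T : ℝ) := Ico_mem_nhdsLT hT0
  obtain ⟨q, hq⟩ : ∃ q, Tendsto (maximalFlow X f) (𝓝[<] (T : ℝ)) (𝓝 q) :=
    cauchy_map_iff_exists_tendsto.1 <| (cauchy_nhds.mono nhdsWithin_le_nhds).map_of_le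
      hB.uniformContinuousOn (le_principal_iff.2 hIco)
  obtain ⟨r, hr, τ, hτ, _, hloc⟩ := hX.exists_lipschitz q
  have hnear : ∀ᶠ s in 𝓝[<] (T : ℝ), s ∈ Ico 0 (T : ℝ) ∧ T - τ < s ∧
      maximalFlow X f s ∈ Metric.ball q r := by
    filter_upwards [hIco, Ioo_mem_nhdsLT (sub_lt_self (T : ℝ) hτ),
      hq (Metric.ball_mem_nhds q hr)] with s hs hsT hsq using ⟨hs, hsT.1, hsq⟩
  obtain ⟨s, hs, hsT, hsq⟩ := hnear.exists
  have hext : HasSolution X f (s + τ) := (hsol s hs).add hX hs.1 hτ.le (hloc _ hsq).1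
  lift s + τ to ℝ≥0 using add_nonneg hs.1 hτ.le with u hu
  have hle : (u : ℝ) ≤ T := NNReal.coe_le_coe.2 (ENNReal.coe_le_coe.1 (hT ▸ hext.le_lifetime))
  linarith

end HasLinearSpeedGrowth

end GlobalFlow

/-! ### The clipping arc field -/

section ClipBounds

variable {a b : EReal} {x v w s t : ℝ}

theorem clip_eq_self_iff (h : a < b) : clip a b x = x ↔ (x : EReal) ∈ Icc a b := by
  rw [← EReal.coe_eq_coe_iff, coe_clip h]
  constructor
  · intro hx
    exact hx ▸ ⟨le_min (le_max_left _ _) h.le, min_le_right _ _⟩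
  · intro hx
    rw [max_eq_right hx.1, min_eq_left hx.2]

theorem coe_clip_of_ge (h : a < b) (hx : b ≤ x) : (clip a b x : EReal) = b := by
  rw [coe_clip h, min_eq_right (hx.trans (le_max_right _ _))]

theorem coe_clip_of_le (h : a < b) (hx : x ≤ a) : (clip a b x : EReal) = a := by
  rw [coe_clip h, max_eq_left hx, min_eq_left h.le]

theorem clip_clip_add_of_nonneg (h : a < b) (hx : a ≤ x) (hw : 0 ≤ w) :
    clip a b (clip a b x + w) = clip a b (x + w) := by
  rcases le_total (x : EReal) b with hxb | hbx
  · rw [(clip_eq_self_iff h).2 ⟨hx, hxb⟩]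
  · have hle : ∀ y : ℝ, (y : EReal) ≤ (y + w : ℝ) := fun y =>
      EReal.coe_le_coe_iff.2 (le_add_of_nonneg_right hw)
    rw [← EReal.coe_eq_coe_iff, coe_clip_of_ge h (hbx.trans (hle x)),
      coe_clip_of_ge h ((coe_clip_of_ge h hbx).ge.trans (hle _))]

theorem clip_clip_add_of_nonpos (h : a < b) (hx : x ≤ b) (hw : w ≤ 0) :
    clip a b (clip a b x + w) = clip a b (x + w) := by
  rcases le_total a (x : EReal) with hax | hxa
  · rw [(clip_eq_self_iff h).2 ⟨hax, hx⟩]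
  · have hle : ∀ y : ℝ, ((y + w : ℝ) : EReal) ≤ y := fun y =>
      EReal.coe_le_coe_iff.2 (add_le_of_nonpos_right hw)
    rw [← EReal.coe_eq_coe_iff, coe_clip_of_le h ((hle x).trans hxa),
      coe_clip_of_le h ((hle _).trans (coe_clip_of_le h hxa).le)]

theorem clip_clip_add_mul (h : a < b) (hx : (x : EReal) ∈ Icc a b) (hs : 0 ≤ s) (ht : 0 ≤ t) :
    clip a b (clip a b (x + s * v) + t * v) = clip a b (x + (s + t) * v) := by
  rw [add_mul, ← add_assoc]
  rcases le_total 0 v with hv | hv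
  · refine clip_clip_add_of_nonneg h (hx.1.trans ?_) (mul_nonneg ht hv)
    exact EReal.coe_le_coe_iff.2 (le_add_of_nonneg_right (mul_nonneg hs hv))
  · refine clip_clip_add_of_nonpos h (le_trans ?_ hx.2) (mul_nonpos_of_nonneg_of_nonpos ht hv)
    exact EReal.coe_le_coe_iff.2 (add_le_of_nonpos_right (mul_nonpos_of_nonneg_of_nonpos hs hv))

end ClipBounds

section BddMeas

variable {Ω : Type*} [MeasurableSpace Ω]

theorem BddMeas.abs_sub_apply_le_dist (g h : BddMeas Ω) (p : Ω) : |g.1 p - h.1 p| ≤ dist g h := by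
  rw [dist_eq_norm]
  exact lp.norm_apply_le_norm ENNReal.top_ne_zero (g - h).1 p

theorem BddMeas.dist_le_of_forall_abs_sub_le {g h : BddMeas Ω} {c : ℝ} (hc : 0 ≤ c)
    (hgh : ∀ p, |g.1 p - h.1 p| ≤ c) : dist g h ≤ c := by
  rw [dist_eq_norm]
  exact lp.norm_le_of_forall_le hc hgh

theorem BddMeas.continuous_coe : Continuous fun g : BddMeas Ω => (g.1 : Ω → ℝ) :=
  lp.uniformContinuous_coe.continuous.comp continuous_subtype_val

instance BddMeas.instCompleteSpace : CompleteSpace (BddMeas Ω) := by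
  have hclosed : IsClosed (BddMeas Ω : Set (lp (fun _ : Ω => ℝ) ∞)) :=
    IsSeqClosed.isClosed fun u g hu hg => measurable_of_tendsto_metrizable hu
      ((lp.uniformContinuous_coe.continuous.tendsto g).comp hg)
  exact hclosed.completeSpace_coe

end BddMeas

section LipschitzGrowth

variable {E F : Type*} [SeminormedAddCommGroup F]

theorem exists_ball_lipschitzOnWith_norm_le [PseudoMetricSpace E] {V : E → F}
    (hV : LocallyLipschitz V) (p : E) : ∃ r > 0, ∃ K C : ℝ≥0,
      LipschitzOnWith K V (Metric.ball p r) ∧ ∀ f ∈ Metric.ball p r, ‖V f‖ ≤ C := by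
  obtain ⟨K, U, hU, hK⟩ := hV p
  have hbdd : ∀ᶠ f in 𝓝 p, ‖V f‖ < ‖V p‖ + 1 :=
    hV.continuous.norm.continuousAt.eventually_lt_const (lt_add_one _)
  obtain ⟨r, hr, hball⟩ := Metric.mem_nhds_iff.1 (inter_mem hU hbdd)
  exact ⟨r, hr, K, ‖V p‖₊ + 1, hK.mono fun f hf => (hball hf).1, fun f hf => (hball hf).2.le⟩

theorem exists_norm_le_mul_one_add_norm [SeminormedAddCommGroup E] {s : Set E} {V : s → F}
    {K : ℝ≥0} (hV : LipschitzWith K V) : ∃ C : ℝ≥0, ∀ f, ‖V f‖ ≤ C * (1 + ‖(f : E)‖) := by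
  rcases isEmpty_or_nonempty s with hs | ⟨⟨p⟩⟩
  · exact ⟨0, fun f => hs.elim f⟩
  refine ⟨‖V p‖₊ + K * ‖(p : E)‖₊ + K, fun f => ?_⟩
  have hVf : ‖V f‖ ≤ ‖V p‖ + K * dist f p := by
    have h := norm_le_norm_add_norm_sub' (V f) (V p)
    rw [← dist_eq_norm] at h
    linarith [hV.dist_le_mul f p]
  have hfp : dist f p ≤ ‖(f : E)‖ + ‖(p : E)‖ := dist_le_norm_add_norm _ _
  calc ‖V f‖ ≤ ‖V p‖ + K * (‖(f : E)‖ + ‖(p : E)‖) := hVf.trans (by gcongr)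
    _ ≤ (‖V p‖ + K * ‖(p : E)‖ + K) * (1 + ‖(f : E)‖) := by
      have : 0 ≤ (‖V p‖ + K * ‖(p : E)‖) * ‖(f : E)‖ := by positivity
      linarith [K.2]

end LipschitzGrowth

section ClipArc

variable {S J : Type*} [MeasurableSpace S] [MeasurableSpace J] {a b : J → S → EReal}

theorem mem_clipSpace_iff (hab : ∀ i x, a i x < b i x) {f : BddMeas (S × J)} :
    f ∈ clipSpace a b ↔ ∀ p, (f.1 p : EReal) ∈ Icc (a p.2 p.1) (b p.2 p.1) :=
  funext_iff.trans (forall_congr' fun p => clip_eq_self_iff (hab p.2 p.1))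

theorem completeSpace_clipSpace (hab : ∀ i x, a i x < b i x) : CompleteSpace (clipSpace a b) := by
  have hInter : clipSpace a b = ⋂ p : S × J,
      {f | (f.1 p : EReal) ∈ Icc (a p.2 p.1) (b p.2 p.1)} := by
    ext f
    rw [mem_iInter]
    exact mem_clipSpace_iff hab
  have hclosed : IsClosed (clipSpace a b) := hInter ▸ isClosed_iInter fun p =>
    isClosed_Icc.preimage
      (continuous_coe_real_ereal.comp ((continuous_apply p).comp BddMeas.continuous_coe))
  exact hclosed.completeSpace_coe

variable (ha : Measurable fun p : S × J => a p.2 p.1) (hb : Measurable fun p : S × J => b p.2 p.1)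
  (hab : ∀ i x, a i x < b i x) {V : clipSpace a b → BddMeas (S × J)}

theorem dist_clipArc_le (f g : clipSpace a b) (s t : I) :
    dist (clipArc ha hb hab V f s) (clipArc ha hb hab V g t) ≤
      dist f g + dist ((s : ℝ) • V f) ((t : ℝ) • V g) := by
  refine BddMeas.dist_le_of_forall_abs_sub_le (by positivity) fun p => ?_
  calc |clip _ _ (f.1.1 p + s * (V f).1 p) - clip _ _ (g.1.1 p + t * (V g).1 p)|
      ≤ |f.1.1 p + s * (V f).1 p - (g.1.1 p + t * (V g).1 p)| := abs_clip_sub_clip_le (hab _ _) _ _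
    _ ≤ |f.1.1 p - g.1.1 p| + |s * (V f).1 p - t * (V g).1 p| := by
      rw [add_sub_add_comm]
      exact abs_add_le _ _
    _ ≤ dist f g + dist ((s : ℝ) • V f) ((t : ℝ) • V g) :=
      add_le_add (BddMeas.abs_sub_apply_le_dist f.1 g.1 p)
        (BddMeas.abs_sub_apply_le_dist ((s : ℝ) • V f) ((t : ℝ) • V g) p)

theorem clipArc_zero (f : clipSpace a b) : clipArc ha hb hab V f 0 = f := by
  refine Subtype.ext (Subtype.ext (lp.ext (funext fun p => ?_)))
  change clip _ _ (f.1.1 p + 0 * (V f).1 p) = f.1.1 p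
  rw [zero_mul, add_zero, clip_eq_self_iff (hab _ _)]
  exact (mem_clipSpace_iff hab).1 f.2 p

theorem dist_clipArc_self_le (f : clipSpace a b) (t : I) :
    dist (clipArc ha hb hab V f t) f ≤ t * ‖V f‖ := by
  have h := dist_clipArc_le ha hb hab (V := V) f f t 0
  rwa [clipArc_zero, dist_self, zero_add, Icc.coe_zero, zero_smul, dist_zero_right, norm_smul,
    Real.norm_of_nonneg t.2.1] at h

theorem dist_clipArc_clipArc_le (f : clipSpace a b) {s t u : I} (hu : (u : ℝ) = s + t) :
    dist (clipArc ha hb hab V f u) (clipArc ha hb hab V (clipArc ha hb hab V f s) t) ≤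
      t * dist (V f) (V (clipArc ha hb hab V f s)) := by
  refine BddMeas.dist_le_of_forall_abs_sub_le (mul_nonneg t.2.1 dist_nonneg) fun p => ?_
  have hf := (mem_clipSpace_iff hab).1 f.2 p
  let y := clip (a p.2 p.1) (b p.2 p.1) (f.1.1 p + s * (V f).1 p)
  calc |clip _ _ (f.1.1 p + u * (V f).1 p) - clip _ _ (y + t * (V (clipArc ha hb hab V f s)).1 p)|
      = |clip _ _ (y + t * (V f).1 p) - clip _ _ (y + t * (V (clipArc ha hb hab V f s)).1 p)| := by
        rw [hu, clip_clip_add_mul (hab _ _) hf s.2.1 t.2.1]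
    _ ≤ |y + t * (V f).1 p - (y + t * (V (clipArc ha hb hab V f s)).1 p)| :=
        abs_clip_sub_clip_le (hab _ _) _ _
    _ = t * |(V f).1 p - (V (clipArc ha hb hab V f s)).1 p| := by
        rw [add_sub_add_left_eq_sub, ← mul_sub, abs_mul, abs_of_nonneg t.2.1]
    _ ≤ t * dist (V f) (V (clipArc ha hb hab V f s)) :=
        mul_le_mul_of_nonneg_left (BddMeas.abs_sub_apply_le_dist _ _ p) t.2.1

theorem isArcField_clipArc (hV : Continuous V) : IsArcField (clipArc ha hb hab V) where
  continuous := by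
    refine continuous_iff_continuousAt.2 fun q => tendsto_iff_dist_tendsto_zero.2 ?_
    have hbound : Continuous fun p : clipSpace a b × I =>
        dist p.1 q.1 + dist ((p.2 : ℝ) • V p.1) ((q.2 : ℝ) • V q.1) := by fun_prop
    exact squeeze_zero (fun _ => dist_nonneg) (fun p => dist_clipArc_le ha hb hab _ _ _ _)
      (by simpa only [dist_self, add_zero] using hbound.tendsto q)
  zero := clipArc_zero ha hb hab

theorem condE1_clipArc (hV : LocallyLipschitz V) : CondE1 (clipArc ha hb hab V) := fun f₀ => by
  obtain ⟨r, hr, K, -, hK, -⟩ := exists_ball_lipschitzOnWith_norm_le hV f₀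
  refine ⟨r, hr, 1, one_pos, K, fun f hf g hg t _ => ?_⟩
  calc dist (clipArc ha hb hab V f t) (clipArc ha hb hab V g t)
      ≤ dist f g + t * dist (V f) (V g) := by
        rw [← Real.norm_of_nonneg t.2.1, ← dist_smul₀]
        exact dist_clipArc_le ha hb hab f g t t
    _ ≤ dist f g + t * (K * dist f g) := by
        gcongr
        exacts [t.2.1, hK.dist_le_mul f hf g hg]
    _ = (1 + t * K) * dist f g := by ring

theorem condE2_clipArc (hV : LocallyLipschitz V) : CondE2 (clipArc ha hb hab V) := fun f₀ => by
  obtain ⟨r, hr, K, C, hK, hC⟩ := exists_ball_lipschitzOnWith_norm_le hV f₀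
  refine ⟨r / 2, by positivity, r / 2 / (C + 1), by positivity, K * C,
    fun f hf s t u hu _ hs => ?_⟩
  have hfr : f ∈ Metric.ball f₀ r := Metric.ball_subset_ball (by linarith) hf
  have hspeed : dist (clipArc ha hb hab V f s) f ≤ s * C :=
    (dist_clipArc_self_le ha hb hab f s).trans (mul_le_mul_of_nonneg_left (hC f hfr) s.2.1)
  have hfs : clipArc ha hb hab V f s ∈ Metric.ball f₀ r := by
    rw [lt_div_iff₀ (by positivity)] at hs
    have htri := dist_triangle (clipArc ha hb hab V f s) f f₀
    exact Metric.mem_ball.2 (by linarith [Metric.mem_ball.1 hf, s.2.1])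
  calc _ ≤ t * dist (V f) (V (clipArc ha hb hab V f s)) := dist_clipArc_clipArc_le ha hb hab f hu
    _ ≤ t * (K * (s * C)) := by
        refine mul_le_mul_of_nonneg_left ((hK.dist_le_mul f hfr _ hfs).trans ?_) t.2.1
        rw [dist_comm]
        gcongr
    _ = s * t * (K * C) := by ring

theorem condSpeed_clipArc (hV : LocallyLipschitz V) : CondSpeed (clipArc ha hb hab V) := by
  intro f₀
  obtain ⟨r, hr, -, C, -, hC⟩ := exists_ball_lipschitzOnWith_norm_le hV f₀
  refine ⟨r, hr, 1, one_pos, C, fun f hf t _ => (dist_clipArc_self_le ha hb hab f t).trans ?_⟩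
  rw [mul_comm]
  exact mul_le_mul_of_nonneg_right (hC f hf) t.2.1

theorem isRegularArcField_clipArc (hV : LocallyLipschitz V) :
    IsRegularArcField (clipArc ha hb hab V) where
  toIsArcField := isArcField_clipArc ha hb hab hV.continuous
  condE1 := condE1_clipArc ha hb hab hV
  condE2 := condE2_clipArc ha hb hab hV
  condSpeed := condSpeed_clipArc ha hb hab hV

theorem hasLinearSpeedGrowth_clipArc {C : ℝ≥0}
    (hC : ∀ f, ‖V f‖ ≤ C * (1 + ‖(f : BddMeas (S × J))‖)) :
    HasLinearSpeedGrowth (clipArc ha hb hab V) := by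
  refine fun p => ⟨C * (1 + ‖(p : BddMeas (S × J))‖₊), fun f t => ?_⟩
  have hf : ‖(f : BddMeas (S × J))‖ ≤ ‖(p : BddMeas (S × J))‖ + dist f p := by
    rw [Subtype.dist_eq, dist_eq_norm]
    exact norm_le_norm_add_norm_sub' _ _
  have hVf : ‖V f‖ ≤ C * ((1 + ‖(p : BddMeas (S × J))‖) * (1 + dist f p)) := by
    refine (hC f).trans (mul_le_mul_of_nonneg_left ?_ C.2)
    have : 0 ≤ ‖(p : BddMeas (S × J))‖ * dist f p := by positivity
    linarith
  calc _ ≤ t * ‖V f‖ := dist_clipArc_self_le ha hb hab f t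
    _ ≤ t * (C * ((1 + ‖(p : BddMeas (S × J))‖) * (1 + dist f p))) :=
        mul_le_mul_of_nonneg_left hVf t.2.1
    _ = C * (1 + ‖(p : BddMeas (S × J))‖) * (1 + dist f p) * t := by ring

end ClipArc

theorem mainTheorem3_general {S J : Type*} [MeasurableSpace S] [MeasurableSpace J]
    (a b : J → S → EReal)
    (ha : Measurable fun p : S × J => a p.2 p.1) (hb : Measurable fun p : S × J => b p.2 p.1)
    (hab : ∀ i x, a i x < b i x)
    (V : clipSpace a b → BddMeas (S × J)) (hV : LocallyLipschitz V) :
    CompleteSpace (clipSpace a b) ∧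
    IsArcField (clipArc ha hb hab V) ∧
    CondE1 (clipArc ha hb hab V) ∧
    CondE2 (clipArc ha hb hab V) ∧
    ∃ (T : clipSpace a b → ℝ≥0∞) (F : clipSpace a b → ℝ≥0 → clipSpace a b),
      IsLocalFlowOf (clipArc ha hb hab V) T F ∧
      (∀ (f : clipSpace a b) (s t : ℝ≥0), (s : ℝ≥0∞) < T f →
        ((t : ℝ≥0∞) < T (F f s) ↔ ((s + t : ℝ≥0) : ℝ≥0∞) < T f)) ∧
      (∀ (T' : clipSpace a b → ℝ≥0∞) (F' : clipSpace a b → ℝ≥0 → clipSpace a b),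
        IsLocalFlowOf (clipArc ha hb hab V) T' F' →
          ∀ f, T' f ≤ T f ∧ ∀ t : ℝ≥0, (t : ℝ≥0∞) < T' f → F' f t = F f t) ∧
      ((∃ C : ℝ≥0, ∀ f, ‖V f‖ ≤ C * (1 + ‖(f : BddMeas (S × J))‖)) →
        (∀ f, T f = ∞) ∧ IsFlowOf (clipArc ha hb hab V) F ∧
          ∀ F', IsFlowOf (clipArc ha hb hab V) F' → F' = F) := by
  have hcomplete := completeSpace_clipSpace hab
  have hX := isRegularArcField_clipArc ha hb hab hV
  refine ⟨hcomplete, hX.toIsArcField, hX.condE1, hX.condE2, lifetime (clipArc ha hb hab V),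
    fun f t => maximalFlow (clipArc ha hb hab V) f t, isLocalFlowOf_maximalFlow hX,
    fun f s t hs => lt_lifetime_maximalFlow_iff hX hs,
    fun T' F' hF' f => ⟨hF'.le_lifetime f, fun t ht => hF'.eq_maximalFlow hX ht⟩, ?_⟩
  rintro ⟨C, hC⟩
  have htop := (hasLinearSpeedGrowth_clipArc ha hb hab hC).lifetime_eq_top hX
  exact ⟨htop, isFlowOf_maximalFlow hX htop, fun F' hF' => hF'.eq_maximalFlow hX⟩

theorem mainTheorem3 {S J : Type*} [MeasurableSpace S] [MeasurableSpace J]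
    (a b : J → S → EReal)
    (ha : Measurable fun p : S × J => a p.2 p.1) (hb : Measurable fun p : S × J => b p.2 p.1)
    (hab : ∀ i x, a i x < b i x) (hgap : 0 < ⨅ (i) (x), (b i x - a i x))
    (V : clipSpace a b → BddMeas (S × J)) (hV : LocallyLipschitz V) :
    CompleteSpace (clipSpace a b) ∧
    IsArcField (clipArc ha hb hab V) ∧
    CondE1 (clipArc ha hb hab V) ∧
    CondE2 (clipArc ha hb hab V) ∧
    ∃ (T : clipSpace a b → ℝ≥0∞) (F : clipSpace a b → ℝ≥0 → clipSpace a b),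
      IsLocalFlowOf (clipArc ha hb hab V) T F ∧
      (∀ (f : clipSpace a b) (s t : ℝ≥0), (s : ℝ≥0∞) < T f →
        ((t : ℝ≥0∞) < T (F f s) ↔ ((s + t : ℝ≥0) : ℝ≥0∞) < T f)) ∧
      (∀ (T' : clipSpace a b → ℝ≥0∞) (F' : clipSpace a b → ℝ≥0 → clipSpace a b),
        IsLocalFlowOf (clipArc ha hb hab V) T' F' →
          ∀ f, T' f ≤ T f ∧ ∀ t : ℝ≥0, (t : ℝ≥0∞) < T' f → F' f t = F f t) ∧
      ((∃ K : ℝ≥0, LipschitzWith K V) →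
        (∀ f, T f = ∞) ∧ IsFlowOf (clipArc ha hb hab V) F ∧
          ∀ F', IsFlowOf (clipArc ha hb hab V) F' → F' = F) :=
  let ⟨hM, hX, h₁, h₂, T, F, hF, hT, hmax, hglobal⟩ := mainTheorem3_general a b ha hb hab V hV
  ⟨hM, hX, h₁, h₂, T, F, hF, hT, hmax, fun ⟨_, hK⟩ => hglobal (exists_norm_le_mul_one_add_norm hK)⟩
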